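/- **Setting.** Let $Q=\{1,\dots,D\}$ be a finite set of modes. A (discrete-time) linear switched system (LSS) $\Sigma$ of dimension $n$ is given by matrices $A_q\in\mathbb R^{n\times n}$, $B_q\in\mathbb R^{n\times m}$, $C_q\in\mathbb R^{p\times n}$, $q\in Q$, and evolves by $x_{t+1}=A_{q_t}x_t+B_{q_t}u_t$, $x_0=0$, $y_t=C_{q_t}x_t$. Its input-output map sends each non-empty finite word $(q_0,u_0)\cdots(q_t,u_t)$ over $Q\times\mathbb R^m$ to the output $y_t\in\mathbb R^p$. Let $f:(Q\times\mathbb R^m)^+\to\mathbb R^p$ be a map. $\Sigma$ is a realization of $f$ if $f$ is its input-output map, and a minimal one if moreover no LSS of smaller dimension is a realization of $f$. For $q_0,q\in Q$ and a word $v=\sigma_1\cdots\sigma_k\in Q^*$ let $S^f(q_0vq)\in\mathbb R^{p\times m}$ be the matrix with $j$th column $f\big((q_0,e_j)(\sigma_1,0)\cdots(\sigma_k,0)(q,0)\big)$. The map $f$ has a generalized convolution representation if $f\big((q_0,u_0)\cdots(q_t,u_t)\big)=\sum_{k=0}^{t-1}S^f(q_k\,q_{k+1}\cdots q_{t-1}\,q_t)\,u_k$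 for all words. Let $M^f(v)$ be the $pD\times mD$ matrix whose block in block row $q$ and block column $q_0$ is $S^f(q_0vq)$. Enumerate $Q^*=\{v_1=\epsilon,v_2,\dots\}$ by length and then lexicographically, and let $\mathbf N(L)$ be the number of words of length at most $L$. The Hankel matrix $H_f$ has block $M^f(v_jv_i)$ in block row $i$ and block column $j$; its rank is the (possibly infinite) dimension of the span of its columns. $H_{f,L,K}$ is the sub-matrix formed by the first $\mathbf N(L)$ block rows and the first $\mathbf N(K)$ block columns. **Algorithm (input $H=H_{f,N,N+1}$, output an LSS $\Sigma_N$).** (1) Let $n=\operatorname{Rank}H$ and choose $n$ columns of $H$ that form a basis of its column space; let $\mathbf O$ be the matrix with these columns, and let $\mathbf R$ be the matrix with $n$ rows whose $r$th column holds the coordinates of the $r$th column of $H$ in this basis, so $H=\mathbf O\mathbf R$. (2) Let $\bar{\mathbf R}$ consist of the first $\mathbf N(N)$ block columns (each of width $mD$) of $\mathbf R$. (3) For $q\in Q$ let $\mathbf R_q$ be the matrix with $\mathbf N(N)$ block columns whose $r$th block column is the $d$th block column of $\mathbf R$, where $v_d=v_rq$. (4) Return the LSS $\Sigma_N$ with $[B_1,\dots,B_D]$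 the first $mD$ columns of $\mathbf R$, $[C_1^T,\dots,C_D^T]^T$ the first $pD$ rows of $\mathbf O$, and $A_q=\mathbf R_q\bar{\mathbf R}^+$ for $q\in Q$, where $^+$ is the Moore-Penrose pseudoinverse. **Theorem.** Let $N\in\mathbb N$. 1. If $f$ has a generalized convolution representation and $\operatorname{Rank}H_{f,N,N}=\operatorname{Rank}H_f$, then, whatever columns are chosen in step (1), the LSS $\Sigma_N$ returned by the algorithm for $H_{f,N,N+1}$ is a minimal realization of $f$. 2. If $f$ has an LSS realization of dimension at most $N+1$, then $\operatorname{Rank}H_{f,N,N}=\operatorname{Rank}H_f$. -/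

import Mathlib

open Matrix

/-- Hybrid inputs `Q × ℝ^m`, where `Q = Fin D` is the set of discrete modes. -/
abbrev HybridInput (D m : ℕ) : Type := Fin D × (Fin m → ℝ)

/-- Non-empty finite words of hybrid inputs. -/
abbrev HybridWord (D m : ℕ) : Type := {w : List (HybridInput D m) // w ≠ []}

/-- Input-output maps: non-empty hybrid words to `ℝ^p`. -/
abbrev IOMap (D m p : ℕ) : Type := HybridWord D m → (Fin p → ℝ)

/-- A discrete-time linear switched system
`x_{t+1} = A_{q_t} x_t + B_{q_t} u_t`, `y_t = C_{q_t} x_t`, `x_0 = 0`,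
with `D` modes, inputs in `ℝ^m`, outputs in `ℝ^p` and state space `ℝ^n` (so of dimension `n`). -/
structure LSS (D m p n : ℕ) where
  A : Fin D → Matrix (Fin n) (Fin n) ℝ
  B : Fin D → Matrix (Fin n) (Fin m) ℝ
  C : Fin D → Matrix (Fin p) (Fin n) ℝ

namespace LSS

variable {D m p n : ℕ}

/-- The state reached from `x` after the hybrid word `w` is fed to the system. -/
def state (S : LSS D m p n) (x : Fin n → ℝ) (w : List (HybridInput D m)) : Fin n → ℝ :=
  w.foldl (fun x a => S.A a.1 *ᵥ x + S.B a.1 *ᵥ a.2) x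

/-- The output from the initial state `x` at the last time instant of `w = v (q, u)`, which is
`C_q` applied to the state reached after `v`. -/
def output (S : LSS D m p n) (x : Fin n → ℝ) (w : HybridWord D m) : Fin p → ℝ :=
  S.C (w.1.getLast w.2).1 *ᵥ S.state x w.1.dropLast

/-- The input-output map of the system: the outputs from the zero initial state. -/
def ioMap (S : LSS D m p n) : IOMap D m p := S.output 0

/-- The system is a realization of `f`. -/
def IsRealization (S : LSS D m p n) (f : IOMap D m p) : Prop := f = S.ioMap

/-- The system is a realization of `f` of the least possible dimension. -/
def IsMinimalRealization (S : LSS D m p n) (f : IOMap D m p) : Prop :=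
  S.IsRealization f ∧ ∀ (k : ℕ) (T : LSS D m p k), T.IsRealization f → n ≤ k

end LSS

/-- The Markov parameter `S^f(q₀ v q)`: its `j`th column is
`f ((q₀, e_j) (σ₁, 0) ⋯ (σ_k, 0) (q, 0))`, for `v = σ₁ ⋯ σ_k`. -/
def markov {D m p : ℕ} (f : IOMap D m p) (q₀ : Fin D) (v : List (Fin D)) (q : Fin D) :
    Matrix (Fin p) (Fin m) ℝ :=
  Matrix.of fun l j =>
    f ⟨(q₀, Pi.single j 1) :: (v.map (fun σ => (σ, 0)) ++ [(q, 0)]), List.cons_ne_nil _ _⟩ l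

/-- `f` has a generalized convolution representation: for every `t` and every hybrid word
`(q_0, u_0) ⋯ (q_t, u_t)`, the value of `f` on it is
`∑_{k < t} S^f(q_k ⬝ q_{k+1} ⋯ q_{t-1} ⬝ q_t) u_k`.
(`List.Ico (k + 1) t` is the list `[k + 1, …, t - 1]`.) -/
def HasGCR {D m p : ℕ} (f : IOMap D m p) : Prop :=
  ∀ (t : ℕ) (q : ℕ → Fin D) (u : ℕ → Fin m → ℝ),
    f ⟨(List.range (t + 1)).map (fun i => (q i, u i)), by simp⟩ =
      ∑ k ∈ Finset.range t, markov f (q k) ((List.Ico (k + 1) t).map q) (q t) *ᵥ u k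

/-- The combined Markov parameter `M^f(v)`, a `D × D` block matrix whose block in block row `q`
and block column `q₀` is `S^f(q₀ v q)`. -/
def combinedMarkov {D m p : ℕ} (f : IOMap D m p) (v : List (Fin D)) :
    Matrix (Fin D × Fin p) (Fin D × Fin m) ℝ :=
  Matrix.of fun r c => markov f c.1 v r.1 r.2 c.2

/-- The Hankel matrix `H_f`. Block rows and block columns are labelled by the words of `Q^*`
themselves rather than by their positions in the length-lexicographic enumeration of `Q^*`;
the block in block row `s` and block column `v` is `M^f(v s)`. -/
def hankel {D m p : ℕ} (f : IOMap D m p) :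
    Matrix (List (Fin D) × Fin D × Fin p) (List (Fin D) × Fin D × Fin m) ℝ :=
  Matrix.of fun r c => combinedMarkov f (c.1 ++ r.1) r.2 c.2

/-- Words over `Q` of length at most `L`. In the length-lexicographic enumeration of `Q^*` these
are exactly the first `𝐍(L)` words. -/
abbrev Word (D L : ℕ) : Type := {v : List (Fin D) // v.length ≤ L}

noncomputable instance (D L : ℕ) : Fintype (Word D L) :=
  (List.finite_length_le (Fin D) L).fintype

/-- The finite upper-left sub-matrix `H_{f,L,K}` of `H_f`: block rows are labelled by words of
length at most `L`, block columns by words of length at most `K`. -/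
def hankelSub {D m p : ℕ} (f : IOMap D m p) (L K : ℕ) :
    Matrix (Word D L × Fin D × Fin p) (Word D K × Fin D × Fin m) ℝ :=
  (hankel f).submatrix (Prod.map Subtype.val id) (Prod.map Subtype.val id)

/-- `X` is the Moore-Penrose pseudoinverse of the real matrix `A`. -/
def IsMoorePenrose {ι κ : Type*} [Fintype ι] [Fintype κ]
    (A : Matrix ι κ ℝ) (X : Matrix κ ι ℝ) : Prop :=
  A * X * A = A ∧ X * A * X = X ∧ (A * X)ᵀ = A * X ∧ (X * A)ᵀ = X * A

theorem IsMoorePenrose.unique {ι κ : Type*} [Fintype ι] [Fintype κ]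
    {A : Matrix ι κ ℝ} {X Y : Matrix κ ι ℝ} (hX : IsMoorePenrose A X) (hY : IsMoorePenrose A Y) :
    X = Y := by
  obtain ⟨x1, x2, x3, x4⟩ := hX
  obtain ⟨y1, y2, y3, y4⟩ := hY
  have h1 : A * X = A * Y := by
    calc A * X = (A * Y * A) * X := by rw [y1]
      _ = (A * Y)ᵀ * (A * X)ᵀ := by rw [y3, x3]; simp only [Matrix.mul_assoc]
      _ = ((A * X * A) * Y)ᵀ := by rw [← Matrix.transpose_mul]; simp only [Matrix.mul_assoc]
      _ = A * Y := by rw [x1, y3]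
  have h2 : X * A = Y * A := by
    calc X * A = X * (A * Y * A) := by rw [y1]
      _ = (X * A)ᵀ * (Y * A)ᵀ := by rw [y4, x4]; simp only [Matrix.mul_assoc]
      _ = (Y * (A * X * A))ᵀ := by rw [← Matrix.transpose_mul]; simp only [Matrix.mul_assoc]
      _ = Y * A := by rw [x1, y4]
  calc X = X * A * X := x2.symm
    _ = Y * A * X := by rw [h2]
    _ = Y * (A * X) := Matrix.mul_assoc _ _ _
    _ = Y * A * Y := by rw [h1, Matrix.mul_assoc]
    _ = Y := y2

theorem exists_isMoorePenrose {ι κ : Type*} [Fintype ι] [Fintype κ] (A : Matrix ι κ ℝ) :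
    ∃ X, IsMoorePenrose A X := by
  classical
  have hG : (Aᵀ * A).IsHermitian := by
    simpa using Matrix.isHermitian_conjTranspose_mul_self A
  -- a symmetric matrix `P` with `G P G = G`, `P G P = P`, `P G = G P` for `G = Aᵀ A`
  obtain ⟨P, hPt, h1, h2, h3⟩ : ∃ P : Matrix κ κ ℝ, Pᵀ = P ∧
      (Aᵀ * A) * P * (Aᵀ * A) = Aᵀ * A ∧ P * (Aᵀ * A) * P = P ∧
      P * (Aᵀ * A) = (Aᵀ * A) * P := by
    generalize Aᵀ * A = G at hG
    obtain ⟨U, d, hU, hGU⟩ : ∃ (U : Matrix κ κ ℝ) (d : κ → ℝ), Uᵀ * U = 1 ∧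
        G = U * diagonal d * Uᵀ := by
      refine ⟨hG.eigenvectorUnitary, hG.eigenvalues, ?_, ?_⟩
      · have := Unitary.coe_star_mul_self hG.eigenvectorUnitary
        simpa [Matrix.star_eq_conjTranspose] using this
      · have := hG.spectral_theorem
        rw [Unitary.conjStarAlgAut_apply] at this
        simpa [Matrix.star_eq_conjTranspose, Function.comp_def] using this
    have key : ∀ a b : κ → ℝ, (U * diagonal a * Uᵀ) * (U * diagonal b * Uᵀ)
        = U * diagonal (fun i => a i * b i) * Uᵀ := by
      intro a b
      calc _ = U * diagonal a * (Uᵀ * U) * diagonal b * Uᵀ := by simp only [Matrix.mul_assoc]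
        _ = _ := by rw [hU, Matrix.mul_one, Matrix.mul_assoc U, diagonal_mul_diagonal]
    have hd : ∀ i, (d i)⁻¹ * d i * (d i)⁻¹ = (d i)⁻¹ := fun i => by
      by_cases h : d i = 0 <;> simp [h]
    refine ⟨U * diagonal (fun i => (d i)⁻¹) * Uᵀ, ?_, ?_, ?_, ?_⟩
    · simp [Matrix.transpose_mul, Matrix.mul_assoc]
    · rw [hGU, key, key]; simp
    · rw [hGU, key, key]; simp [hd]
    · rw [hGU, key, key]; simp [mul_comm]
  have h4 : A * (P * (Aᵀ * A)) = A := by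
    have h0 : (A * (P * (Aᵀ * A)) - A)ᵀ * (A * (P * (Aᵀ * A)) - A) = 0 := by
      have e1 : A * (P * (Aᵀ * A)) - A = A * (P * (Aᵀ * A) - 1) := by
        rw [Matrix.mul_sub, Matrix.mul_one]
      have e2 : (Aᵀ * A) * (P * (Aᵀ * A) - 1) = 0 := by
        rw [Matrix.mul_sub, Matrix.mul_one, ← Matrix.mul_assoc, h1, sub_self]
      rw [e1, Matrix.transpose_mul, Matrix.mul_assoc, ← Matrix.mul_assoc Aᵀ, e2, Matrix.mul_zero]
    have := (Matrix.conjTranspose_mul_self_eq_zero (A := A * (P * (Aᵀ * A)) - A)).1 (by simpa using h0)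
    exact sub_eq_zero.1 this
  refine ⟨P * Aᵀ, ?_, ?_, ?_, ?_⟩
  · simpa only [Matrix.mul_assoc] using h4
  · calc P * Aᵀ * A * (P * Aᵀ) = (P * (Aᵀ * A) * P) * Aᵀ := by simp only [Matrix.mul_assoc]
      _ = _ := by rw [h2]
  · simp [Matrix.transpose_mul, Matrix.mul_assoc, hPt]
  · rw [Matrix.mul_assoc, Matrix.transpose_mul, hPt, Matrix.transpose_mul,
      Matrix.transpose_transpose, h3]

/-- The Moore-Penrose pseudoinverse of a real matrix. -/
noncomputable def pinv {ι κ : Type*} [Fintype ι] [Fintype κ] (A : Matrix ι κ ℝ) :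
    Matrix κ ι ℝ :=
  (exists_isMoorePenrose A).choose

theorem pinv_spec {ι κ : Type*} [Fintype ι] [Fintype κ] (A : Matrix ι κ ℝ) :
    IsMoorePenrose A (pinv A) :=
  (exists_isMoorePenrose A).choose_spec

/-- A choice of `n = Rank H` columns of `H` that form a basis of the column space of `H`. -/
structure ColumnChoice {ι κ : Type*} [Fintype κ] (H : Matrix ι κ ℝ) where
  idx : Fin H.rank → κ
  linInd : LinearIndependent ℝ (fun r => H.col (idx r))
  span_eq : Submodule.span ℝ (Set.range fun r => H.col (idx r)) =
    Submodule.span ℝ (Set.range H.col)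

/-- Such a choice always exists. -/
theorem ColumnChoice.nonempty {ι κ : Type*} [Fintype κ] (H : Matrix ι κ ℝ) :
    Nonempty (ColumnChoice H) := by
  have : Module.Finite ℝ (Submodule.span ℝ (Set.range H.col)) :=
    Module.Finite.span_of_finite ℝ (Set.finite_range _)
  have hr : H.rank = Module.finrank ℝ (Submodule.span ℝ (Set.range H.col)) :=
    H.rank_eq_finrank_span_cols
  obtain ⟨f, hf, hspan, hli⟩ :
      ∃ f : Fin H.rank → ι → ℝ, (∀ i, f i ∈ Set.range H.col) ∧
        Submodule.span ℝ (Set.range f) = Submodule.span ℝ (Set.range H.col) ∧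
        LinearIndependent ℝ f := by
    rw [hr]
    exact Submodule.exists_fun_fin_finrank_span_eq ℝ (Set.range H.col)
  choose idx hidx using hf
  have e : (fun r => H.col (idx r)) = f := funext hidx
  exact ⟨⟨idx, e ▸ hli, e ▸ hspan⟩⟩

namespace ColumnChoice

variable {ι κ : Type*} [Fintype κ] {H : Matrix ι κ ℝ}

/-- The matrix `𝐎` formed by the chosen columns. -/
def O (c : ColumnChoice H) : Matrix ι (Fin H.rank) ℝ := H.submatrix id c.idx

/-- The matrix `𝐑` whose `k`th column holds the coordinates of the `k`th column of `H` with
respect to the basis formed by the chosen columns. -/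
noncomputable def R (c : ColumnChoice H) : Matrix (Fin H.rank) κ ℝ :=
  Matrix.of fun r k =>
    (Module.Basis.span c.linInd).repr
      ⟨H.col k, c.span_eq.symm ▸ Submodule.subset_span (Set.mem_range_self k)⟩ r

end ColumnChoice

/-- The realization algorithm. Its input is a matrix `H` of the size of `H_{f,N,N+1}`, together
with the columns chosen in its first step; its output is a system of dimension `Rank H`. -/
noncomputable def realizationAlgorithm {D m p N : ℕ}
    {H : Matrix (Word D N × Fin D × Fin p) (Word D (N + 1) × Fin D × Fin m) ℝ}
    (c : ColumnChoice H) : LSS D m p H.rank :=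
  -- the first `J_N` columns of `𝐑`, those labelled by words of length at most `N`
  let Rbar : Matrix (Fin H.rank) (Word D N × Fin D × Fin m) ℝ :=
    Matrix.of fun r k => c.R r (⟨k.1.1, k.1.2.trans N.le_succ⟩, k.2)
  -- the column labelled `(v, z)` of `𝐑_q` is the column of `𝐑` labelled `(v q, z)`
  let Rshift : Fin D → Matrix (Fin H.rank) (Word D N × Fin D × Fin m) ℝ := fun q =>
    Matrix.of fun r k => c.R r (⟨k.1.1 ++ [q], by simpa using k.1.2⟩, k.2)
  { A := fun q => Rshift q * pinv Rbar
    -- the block columns of `𝐑` labelled by the empty word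
    B := fun q => Matrix.of fun r j => c.R r (⟨[], Nat.zero_le _⟩, q, j)
    -- the block rows of `𝐎` labelled by the empty word
    C := fun q => Matrix.of fun l r => c.O (⟨[], Nat.zero_le _⟩, q, l) r }

/-! The column space of `H_f` carries a canonical realization. The block at `(s, v)` depends only on
the word `v s`, so replacing row `s` by row `q s` turns column `v` into column `v q`: row shifts act
on the column space. Taking the ε-columns as input maps, the shifts as dynamics and evaluation at
the ε-rows as outputs gives the Markov parameters of `f`, and these determine `f` by `HasGCR`. The
rank condition lets coordinates in this infinite space be read off the finite block
(`exists_basis_colSpace`), so the algorithm returns exactly this realization in a basis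
(`realizationAlgorithm_markov`).

Minimality and the second claim rest on the factorization of `H_f` into observability times
reachability (`hankel_ioMap`). It bounds the rank by the dimension of any realization. Moreover,
Krylov chains in ℝ^n are exhausted by words of length below `n` (`prod_mulVec_mem_span`), so short
words already carry the full rank. -/

/-! ### Markov parameters of a system and factorization of its Hankel matrix. -/

namespace LSS

variable {D m p n : ℕ}

/-- The product `A_{σ_k} ⋯ A_{σ_1}` of the state matrices along the word `σ_1 ⋯ σ_k`. -/
def transition (S : LSS D m p n) (v : List (Fin D)) : Matrix (Fin n) (Fin n) ℝ :=
  (v.reverse.map S.A).prod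

@[simp]
theorem transition_nil (S : LSS D m p n) : S.transition [] = 1 := by simp [transition]

theorem transition_append (S : LSS D m p n) (v w : List (Fin D)) :
    S.transition (v ++ w) = S.transition w * S.transition v := by simp [transition]

theorem transition_concat (S : LSS D m p n) (v : List (Fin D)) (q : Fin D) :
    S.transition (v ++ [q]) = S.A q * S.transition v := by simp [transition]

theorem state_map_zero_input (S : LSS D m p n) (x : Fin n → ℝ) (v : List (Fin D)) :
    S.state x (v.map fun σ => (σ, 0)) = S.transition v *ᵥ x := by
  induction v using List.reverseRecOn with
  | nil => simp [state]
  | append_singleton v q ih =>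
    rw [transition_concat, ← mulVec_mulVec, ← ih]
    simp [state]

theorem state_range_map (S : LSS D m p n) (q : ℕ → Fin D) (u : ℕ → Fin m → ℝ) (t : ℕ) :
    S.state 0 ((List.range t).map fun i => (q i, u i)) =
      ∑ k ∈ Finset.range t,
        S.transition ((List.Ico (k + 1) t).map q) *ᵥ (S.B (q k) *ᵥ u k) := by
  induction t with
  | zero => simp [state]
  | succ t ih =>
    have hstep : S.state 0 ((List.range (t + 1)).map fun i => (q i, u i)) =
        S.A (q t) *ᵥ S.state 0 ((List.range t).map fun i => (q i, u i)) + S.B (q t) *ᵥ u t := by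
      simp [state, List.range_succ]
    rw [hstep, ih, Finset.sum_range_succ, mulVec_sum]
    congr 1
    · refine Finset.sum_congr rfl fun k hk => ?_
      rw [List.Ico.succ_top (Finset.mem_range.1 hk), List.map_append, List.map_singleton,
        transition_concat, mulVec_mulVec]
    · simp

theorem markov_ioMap (S : LSS D m p n) (q₀ : Fin D) (v : List (Fin D)) (q : Fin D) :
    markov S.ioMap q₀ v q = S.C q * S.transition v * S.B q₀ := by
  ext l j
  have hst : S.state 0 ((q₀, Pi.single j 1) :: v.map fun σ => (σ, 0)) =
      S.transition v *ᵥ (S.B q₀ *ᵥ Pi.single j 1) := by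
    rw [← state_map_zero_input]
    simp [state]
  have hdrop : ((q₀, (Pi.single j 1 : Fin m → ℝ)) :: (v.map (fun σ => (σ, 0)) ++ [(q, 0)])).dropLast =
      (q₀, Pi.single j 1) :: v.map fun σ => (σ, 0) := by
    rw [← List.cons_append, List.dropLast_concat]
  have hlast : ∀ h, ((q₀, (Pi.single j 1 : Fin m → ℝ)) ::
      (v.map (fun σ => (σ, 0)) ++ [(q, 0)])).getLast h = (q, 0) := by
    intro h
    rw [List.getLast_cons (by simp), List.getLast_append_singleton]
  simp only [markov, of_apply, ioMap, output, hdrop, hlast, hst, mulVec_mulVec]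
  rw [mulVec_single_one, ← Matrix.mul_assoc]
  rfl

theorem ioMap_range_map (S : LSS D m p n) (t : ℕ) (q : ℕ → Fin D) (u : ℕ → Fin m → ℝ) :
    S.ioMap ⟨(List.range (t + 1)).map (fun i => (q i, u i)), by simp⟩ =
      ∑ k ∈ Finset.range t,
        (S.C (q t) * S.transition ((List.Ico (k + 1) t).map q) * S.B (q k)) *ᵥ u k := by
  simp only [ioMap, output, List.range_succ, List.map_append, List.map_singleton,
    List.getLast_append_singleton, List.dropLast_concat, state_range_map, mulVec_sum,
    mulVec_mulVec, Matrix.mul_assoc]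

/-- The observability matrix; the rows labelled by the word `s` are those of `C_q A_s`. -/
def obs (S : LSS D m p n) : Matrix (List (Fin D) × Fin D × Fin p) (Fin n) ℝ :=
  Matrix.of fun r i => (S.C r.2.1 * S.transition r.1) r.2.2 i

/-- The reachability matrix; the columns labelled by the word `v` are those of `A_v B_q`. -/
def reach (S : LSS D m p n) : Matrix (Fin n) (List (Fin D) × Fin D × Fin m) ℝ :=
  Matrix.of fun i c => (S.transition c.1 * S.B c.2.1) i c.2.2

theorem hankel_ioMap (S : LSS D m p n) : hankel S.ioMap = S.obs * S.reach := by
  ext r c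
  simp only [hankel, combinedMarkov, of_apply, markov_ioMap, transition_append]
  have : S.C r.2.1 * (S.transition r.1 * S.transition c.1) * S.B c.2.1 =
      (S.C r.2.1 * S.transition r.1) * (S.transition c.1 * S.B c.2.1) := by
    simp only [Matrix.mul_assoc]
  rw [this]
  rfl

end LSS

theorem exists_range_map_eq {D m : ℕ} (w : HybridWord D m) :
    ∃ (t : ℕ) (q : ℕ → Fin D) (u : ℕ → Fin m → ℝ),
      w = ⟨(List.range (t + 1)).map (fun i => (q i, u i)), by simp⟩ := by
  obtain ⟨w, hw⟩ := w
  -- The head is only a filler beyond the end of `w`; with `D` arbitrary, no fixed mode is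
  -- available.
  refine ⟨w.length - 1, fun i => (w.getD i (w.head hw)).1, fun i => (w.getD i (w.head hw)).2, ?_⟩
  have hl : w.length - 1 + 1 = w.length := Nat.sub_add_cancel (List.length_pos_iff.2 hw)
  refine Subtype.ext (List.ext_getElem (by simp [hl]) fun i h₁ h₂ => ?_)
  simp [h₁]

/-- A system realizes a map with a generalized convolution representation as soon as its
Markov parameters are those of the map. -/
theorem HasGCR.isRealization {D m p n : ℕ} {f : IOMap D m p} (hf : HasGCR f)
    (S : LSS D m p n) (h : ∀ q₀ v q, markov f q₀ v q = S.C q * S.transition v * S.B q₀) :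
    S.IsRealization f := by
  funext w
  obtain ⟨t, q, u, rfl⟩ := exists_range_map_eq w
  rw [hf, S.ioMap_range_map]
  simp only [h]

/-! ### Ranks of products and of their sub-matrices. -/

section Rank

variable {ι κ ι₀ κ₀ : Type}

theorem map_mulVecLin_span_col {ν : Type*} [Fintype ν] (O : Matrix ι ν ℝ) (R : Matrix ν κ ℝ) :
    (Submodule.span ℝ (Set.range R.col)).map O.mulVecLin =
      Submodule.span ℝ (Set.range (O * R).col) := by
  rw [Submodule.map_span, ← Set.range_comp]
  rfl

theorem eRank_mul_le {n : ℕ} (O : Matrix ι (Fin n) ℝ) (R : Matrix (Fin n) κ ℝ) :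
    (O * R).eRank ≤ n := by
  have h : (O * R).cRank ≤ (n : Cardinal) := by
    rw [cRank, ← map_mulVecLin_span_col]
    refine (rank_map_le _ _).trans ((Submodule.rank_le _).trans ?_)
    simp
  rw [eRank]
  exact Cardinal.toENat_le_natCast.2 h

/-- Dropping columns leaves the span of the columns of `R` intact. Dropping rows is injective on the
range of `O`: if the kept rows annihilate `x`, so do all rows, which lie in their span. -/
theorem eRank_submatrix_mul_eq {n : ℕ} (O : Matrix ι (Fin n) ℝ) (R : Matrix (Fin n) κ ℝ)
    (a : ι₀ → ι) (b : κ₀ → κ)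
    (ha : Set.range O.row ⊆ Submodule.span ℝ (Set.range fun i => O.row (a i)))
    (hb : Set.range R.col ⊆ Submodule.span ℝ (Set.range fun j => R.col (b j))) :
    ((O * R).submatrix a b).eRank = (O * R).eRank := by
  have hspan : Submodule.span ℝ (Set.range (R.submatrix id b).col) =
      Submodule.span ℝ (Set.range R.col) := by
    refine le_antisymm (Submodule.span_mono ?_) (Submodule.span_le.2 hb)
    rintro _ ⟨j, rfl⟩
    exact ⟨b j, rfl⟩
  let ρ : (ι → ℝ) →ₗ[ℝ] (ι₀ → ℝ) := LinearMap.funLeft ℝ ℝ a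
  have hker : ∀ x, ρ (O *ᵥ x) = 0 → O *ᵥ x = 0 := by
    intro x hx
    have hle : Submodule.span ℝ (Set.range fun i => O.row (a i)) ≤
        LinearMap.ker ((dotProductBilin ℝ ℝ).flip x) := by
      rw [Submodule.span_le]
      rintro _ ⟨i, rfl⟩
      exact congrFun hx i
    funext i
    exact hle (ha ⟨i, rfl⟩)
  have hsub : (O * R).submatrix a b = O.submatrix a id * R.submatrix id b := by
    ext; rfl
  have hcomp : (O.submatrix a id).mulVecLin = ρ ∘ₗ O.mulVecLin := by
    ext; rfl
  rw [eRank, eRank, cRank, cRank, hsub, ← map_mulVecLin_span_col, ← map_mulVecLin_span_col, hspan,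
    hcomp, Submodule.map_comp]
  have hinj : Function.Injective
      (ρ.domRestrict ((Submodule.span ℝ (Set.range R.col)).map O.mulVecLin)) := by
    rw [← LinearMap.ker_eq_bot, LinearMap.ker_eq_bot']
    rintro ⟨_, x, _, rfl⟩ h
    exact Subtype.ext (hker x h)
  rw [← LinearMap.range_domRestrict, (LinearEquiv.ofInjective _ hinj).rank_eq]

end Rank

/-! ### Saturation of Krylov-type chains. -/

section Saturation

variable {V : Type*} [AddCommGroup V] [Module ℝ V]

/-- Each strict step costs a dimension, so a stall occurs by index `N`, and `hstep` propagates it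
forever. -/
theorem submodule_chain_stable [FiniteDimensional ℝ V] {X : ℕ → Submodule ℝ V} (hmono : Monotone X)
    (hstep : ∀ k, X k = X (k + 1) → X (k + 1) = X (k + 2)) {N : ℕ}
    (hN : Module.finrank ℝ V ≤ N) (j : ℕ) : X j ≤ X N := by
  obtain ⟨k, hk, hkk⟩ : ∃ k ≤ N, X k = X (k + 1) := by
    by_contra! hne
    have hlt : ∀ k ≤ N + 1, k ≤ Module.finrank ℝ (X k) := by
      intro k hk
      induction k with
      | zero => exact Nat.zero_le _
      | succ k ih =>
        exact (ih (by omega)).trans_lt (Submodule.finrank_lt_finrank_of_lt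
          ((hmono k.le_succ).lt_of_ne (hne k (by omega))))
    have := hlt (N + 1) le_rfl
    have := (X (N + 1)).finrank_le
    omega
  have hconst : ∀ i, X (k + i) = X k ∧ X (k + i) = X (k + i + 1) := by
    intro i
    induction i with
    | zero => exact ⟨rfl, hkk⟩
    | succ i ih => exact ⟨ih.2.symm.trans ih.1, hstep _ ih.2⟩
  exact (hmono (show j ≤ k + j by omega)).trans ((hconst j).1.le.trans (hmono hk))

theorem prod_mulVec_mem_span {D n N : ℕ} (A : Fin D → Matrix (Fin n) (Fin n) ℝ)
    (G : Set (Fin n → ℝ)) (hN : n ≤ N + 1) (v : List (Fin D)) {g : Fin n → ℝ} (hg : g ∈ G) :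
    (v.map A).prod *ᵥ g ∈ Submodule.span ℝ
      {x | ∃ w : List (Fin D), w.length ≤ N ∧ ∃ g ∈ G, (w.map A).prod *ᵥ g = x} := by
  -- With strict length bounds the chain starts at zero, and its term `N + 1` consists of the words
  -- of length at most `N`.
  let X : ℕ → Submodule ℝ (Fin n → ℝ) := fun k => Submodule.span ℝ
    {x | ∃ w : List (Fin D), w.length < k ∧ ∃ g ∈ G, (w.map A).prod *ᵥ g = x}
  have hmono : Monotone X := fun i j hij => Submodule.span_mono
    fun x ⟨w, hw, h⟩ => ⟨w, hw.trans_le hij, h⟩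
  have hstep : ∀ k, X k = X (k + 1) → X (k + 1) = X (k + 2) := by
    intro k hk
    refine le_antisymm (hmono (Nat.le_succ _)) (Submodule.span_le.2 ?_)
    rintro _ ⟨w, hw, g, hg, rfl⟩
    cases w with
    | nil => exact Submodule.subset_span ⟨[], by simp, g, hg, rfl⟩
    | cons q w =>
      have hmem : (w.map A).prod *ᵥ g ∈ X k := by
        rw [hk]
        exact Submodule.subset_span ⟨w, by simpa using hw, g, hg, rfl⟩
      have hle : X k ≤ (X (k + 1)).comap (A q).mulVecLin := by
        refine Submodule.span_le.2 ?_
        rintro _ ⟨w', hw', g', hg', rfl⟩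
        exact Submodule.subset_span ⟨q :: w', by simpa using hw', g', hg', by simp⟩
      simpa using hle hmem
  have h := submodule_chain_stable hmono hstep (N := N + 1) (by simpa using hN) (v.length + 1)
    (Submodule.subset_span ⟨v, Nat.lt_succ_self _, g, hg, rfl⟩)
  simpa only [X, Nat.lt_succ_iff] using h

end Saturation

theorem LSS.eRank_hankelSub_ioMap {D m p n N : ℕ} (S : LSS D m p n) (hn : n ≤ N + 1) :
    (hankelSub S.ioMap N N).eRank = (hankel S.ioMap).eRank := by
  rw [hankelSub, S.hankel_ioMap]
  apply eRank_submatrix_mul_eq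
  · rintro _ ⟨⟨s, q, l⟩, rfl⟩
    -- Transposition undoes the reversal in `transition`, so rows need no reversed words, whereas
    -- columns do.
    have hrow : ∀ (s : List (Fin D)) (q : Fin D) (l : Fin p),
        S.obs.row (s, q, l) = (s.map fun σ => (S.A σ)ᵀ).prod *ᵥ S.C q l := by
      intro s q l
      have : (s.map fun σ => (S.A σ)ᵀ).prod = (S.transition s)ᵀ := by
        simp [LSS.transition, transpose_list_prod, Function.comp_def]
      rw [this, mulVec_transpose]
      rfl
    rw [SetLike.mem_coe, hrow]
    refine Submodule.span_mono ?_ (prod_mulVec_mem_span (fun σ => (S.A σ)ᵀ)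
      (Set.range fun z : Fin D × Fin p => S.C z.1 z.2) hn s ⟨(q, l), rfl⟩)
    rintro _ ⟨w, hw, _, ⟨z, rfl⟩, rfl⟩
    exact ⟨(⟨w, hw⟩, z), hrow w z.1 z.2⟩
  · rintro _ ⟨⟨v, q, j⟩, rfl⟩
    have hcol : ∀ (v : List (Fin D)) (q : Fin D) (j : Fin m),
        S.reach.col (v, q, j) = (v.reverse.map S.A).prod *ᵥ (S.B q).col j := fun _ _ _ => rfl
    rw [SetLike.mem_coe, hcol]
    refine Submodule.span_mono ?_ (prod_mulVec_mem_span S.A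
      (Set.range fun z : Fin D × Fin m => (S.B z.1).col z.2) hn v.reverse ⟨(q, j), rfl⟩)
    rintro _ ⟨w, hw, _, ⟨z, rfl⟩, rfl⟩
    exact ⟨(⟨w.reverse, by simpa using hw⟩, z), by simp [hcol]⟩

/-! ### Recovering the full column space from a sub-matrix of equal rank. -/

section ColumnSpace

variable {ι κ ι₀ κ₀ : Type}

/-- The column space of a matrix. -/
abbrev colSpace (H : Matrix ι κ ℝ) : Submodule ℝ (ι → ℝ) := Submodule.span ℝ (Set.range H.col)

theorem finite_colSpace_of_eRank_submatrix_eq [Fintype κ₀] {H : Matrix ι κ ℝ} {a : ι₀ → ι}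
    {b : κ₀ → κ} (h : (H.submatrix a b).eRank = H.eRank) : Module.Finite ℝ (colSpace H) := by
  rw [← Module.rank_lt_aleph0_iff, ← Cardinal.toENat_lt_top]
  change H.eRank < ⊤
  rw [← h]
  exact (eRank_le_card_width _).trans_lt (by simp)

theorem rank_submatrix_eq_finrank_colSpace [Fintype κ₀] {H : Matrix ι κ ℝ} {a : ι₀ → ι}
    {b : κ₀ → κ} (h : (H.submatrix a b).eRank = H.eRank) :
    (H.submatrix a b).rank = Module.finrank ℝ (colSpace H) := by
  rw [rank_eq_finrank_span_cols, ← eRank_toNat_eq_finrank, h, eRank_toNat_eq_finrank]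

/-- Selecting columns and then restricting rows can each only lower the dimension; as the final
dimension equals the initial one, neither loses anything. -/
theorem colSpace_of_eRank_submatrix_eq [Fintype κ₀] {H : Matrix ι κ ℝ} {a : ι₀ → ι}
    {b : κ₀ → κ} (h : (H.submatrix a b).eRank = H.eRank) :
    Submodule.span ℝ (Set.range fun k => H.col (b k)) = colSpace H ∧
      Function.Injective ((LinearMap.funLeft ℝ ℝ a).domRestrict (colSpace H)) := by
  have hfin := finite_colSpace_of_eRank_submatrix_eq h
  have hrank := rank_submatrix_eq_finrank_colSpace h
  have hle : Submodule.span ℝ (Set.range fun k => H.col (b k)) ≤ colSpace H :=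
    Submodule.span_mono (by rintro _ ⟨k, rfl⟩; exact ⟨b k, rfl⟩)
  have hmap : (Submodule.span ℝ (Set.range fun k => H.col (b k))).map (LinearMap.funLeft ℝ ℝ a) =
      colSpace (H.submatrix a b) := by
    rw [Submodule.map_span, ← Set.range_comp]
    rfl
  have hfinU : Module.Finite ℝ (Submodule.span ℝ (Set.range fun k => H.col (b k))) :=
    Module.Finite.span_of_finite ℝ (Set.finite_range _)
  have hU : Module.finrank ℝ (colSpace H) ≤
      Module.finrank ℝ (Submodule.span ℝ (Set.range fun k => H.col (b k))) := by
    rw [← hrank, rank_eq_finrank_span_cols]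
    change Module.finrank ℝ (colSpace (H.submatrix a b)) ≤ _
    rw [← hmap]
    exact Submodule.finrank_map_le _ _
  have heq := Submodule.eq_of_le_of_finrank_le hle hU
  refine ⟨heq, ?_⟩
  have hker := LinearMap.finrank_range_add_finrank_ker
    ((LinearMap.funLeft ℝ ℝ a).domRestrict (colSpace H))
  rw [LinearMap.range_domRestrict, ← heq, hmap, heq] at hker
  rw [← LinearMap.ker_eq_bot]
  rw [rank_eq_finrank_span_cols] at hrank
  exact Submodule.finrank_eq_zero.1 (Nat.add_left_cancel (hker.trans hrank.symm))

namespace ColumnChoice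

theorem sum_R_smul_col [Fintype κ] {H : Matrix ι κ ℝ} (c : ColumnChoice H) (k : κ) :
    ∑ r, c.R r k • H.col (c.idx r) = H.col k := by
  have h := (Module.Basis.span c.linInd).sum_repr
    ⟨H.col k, c.span_eq.symm ▸ Submodule.subset_span (Set.mem_range_self k)⟩
  have h' := congrArg Subtype.val h
  simpa [Module.Basis.span_apply, R] using h'

/-- Columns chosen in a sub-matrix of full rank extend to a basis of the column space of the whole
matrix, and the coordinates in that basis are those computed from the sub-matrix. -/
theorem exists_basis_colSpace [Fintype κ₀] {H : Matrix ι κ ℝ} {a : ι₀ → ι} {b : κ₀ → κ}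
    (h : (H.submatrix a b).eRank = H.eRank) (c : ColumnChoice (H.submatrix a b)) :
    ∃ e : Module.Basis (Fin (H.submatrix a b).rank) ℝ (colSpace H),
      (∀ r, (e r : ι → ℝ) = H.col (b (c.idx r))) ∧
      ∀ k, ⇑(e.repr ⟨H.col (b k), Submodule.subset_span (Set.mem_range_self _)⟩) =
        fun r => c.R r k := by
  have hfin := finite_colSpace_of_eRank_submatrix_eq h
  have hinj := (colSpace_of_eRank_submatrix_eq h).2
  let w : Fin (H.submatrix a b).rank → colSpace H := fun r =>
    ⟨H.col (b (c.idx r)), Submodule.subset_span (Set.mem_range_self _)⟩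
  have hw : LinearIndependent ℝ w :=
    LinearIndependent.of_comp ((LinearMap.funLeft ℝ ℝ a).domRestrict (colSpace H)) c.linInd
  let e := basisOfLinearIndependentOfCardEqFinrank' w hw
    (by rw [Fintype.card_fin, rank_submatrix_eq_finrank_colSpace h])
  have he : ∀ r, e r = w r := fun r => by simp [e]
  refine ⟨e, fun r => by rw [he], fun k => ?_⟩
  have hsum : ∑ r, c.R r k • e r = ⟨H.col (b k), Submodule.subset_span (Set.mem_range_self _)⟩ := by
    -- By injectivity, the expansion need only be checked on the retained rows.
    apply hinj
    rw [map_sum]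
    simp only [map_smul, he]
    exact c.sum_R_smul_col k
  rw [← hsum, e.repr_sum_self]

end ColumnChoice

end ColumnSpace

/-- Every unit vector is some `M y`, and `M M⁺ M = M`. -/
theorem mul_pinv_eq_one {κ : Type*} [Fintype κ] {n : ℕ} {M : Matrix (Fin n) κ ℝ}
    (hM : ⊤ ≤ Submodule.span ℝ (Set.range M.col)) : M * pinv M = 1 := by
  refine ext_of_mulVec_single fun i => ?_
  have hx : Pi.single i 1 ∈ Submodule.span ℝ (Set.range M.col) := hM trivial
  rw [← range_mulVecLin] at hx
  obtain ⟨y, hy⟩ := hx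
  rw [← hy, mulVecLin_apply, mulVec_mulVec, (pinv_spec M).1, one_mulVec]

/-! ### The shift realization and the output of the algorithm. -/

section Realization

variable {D m p : ℕ}

/-- The shift of functions on the rows of the Hankel matrix: the row `s` is replaced by `q s`. -/
def rowShift (D p : ℕ) (q : Fin D) :
    (List (Fin D) × Fin D × Fin p → ℝ) →ₗ[ℝ] (List (Fin D) × Fin D × Fin p → ℝ) :=
  LinearMap.funLeft ℝ ℝ fun r => (q :: r.1, r.2)

theorem rowShift_hankel_col (f : IOMap D m p) (q : Fin D) (v : List (Fin D)) (z : Fin D × Fin m) :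
    rowShift D p q ((hankel f).col (v, z)) = (hankel f).col (v ++ [q], z) := by
  funext r
  simp [rowShift, hankel, LinearMap.funLeft_apply]

theorem rowShift_mem_colSpace (f : IOMap D m p) (q : Fin D) :
    ∀ x ∈ colSpace (hankel f), rowShift D p q x ∈ colSpace (hankel f) := by
  change colSpace (hankel f) ≤ (colSpace (hankel f)).comap (rowShift D p q)
  refine Submodule.span_le.2 ?_
  rintro _ ⟨⟨v, z⟩, rfl⟩
  rw [SetLike.mem_coe, Submodule.mem_comap, rowShift_hankel_col]
  exact Submodule.subset_span (Set.mem_range_self _)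

/-- A column of the Hankel matrix as an element of its column space. -/
def hankelCol (f : IOMap D m p) (k : List (Fin D) × Fin D × Fin m) : colSpace (hankel f) :=
  ⟨(hankel f).col k, Submodule.subset_span (Set.mem_range_self k)⟩

theorem realizationAlgorithm_markov {N : ℕ} (f : IOMap D m p)
    (h : (hankelSub f N N).eRank = (hankel f).eRank) (c : ColumnChoice (hankelSub f N (N + 1)))
    (h' : (hankelSub f N (N + 1)).eRank = (hankel f).eRank) (q₀ : Fin D) (v : List (Fin D))
    (q : Fin D) :
    markov f q₀ v q = (realizationAlgorithm c).C q *
      (realizationAlgorithm c).transition v * (realizationAlgorithm c).B q₀ := by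
  obtain ⟨e, he, hrepr⟩ : ∃ e : Module.Basis (Fin (hankelSub f N (N + 1)).rank) ℝ
      (colSpace (hankel f)),
      (∀ r, (e r : _ → ℝ) = (hankel f).col (Prod.map Subtype.val id (c.idx r))) ∧
      ∀ k : Word D (N + 1) × Fin D × Fin m,
        ⇑(e.repr (hankelCol f (Prod.map Subtype.val id k))) = fun r => c.R r k :=
    c.exists_basis_colSpace h'
  let T : Fin D → colSpace (hankel f) →ₗ[ℝ] colSpace (hankel f) := fun q =>
    (rowShift D p q).restrict (rowShift_mem_colSpace f q)
  have hT : ∀ q v z, T q (hankelCol f (v, z)) = hankelCol f (v ++ [q], z) := fun q v z =>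
    Subtype.ext (rowShift_hankel_col f q v z)
  let Rbar : Matrix (Fin (hankelSub f N (N + 1)).rank) (Word D N × Fin D × Fin m) ℝ :=
    Matrix.of fun r k => c.R r (⟨k.1.1, k.1.2.trans N.le_succ⟩, k.2)
  have hRbar : ∀ k, Rbar.col k = e.equivFun (hankelCol f (k.1.1, k.2)) := fun k =>
    (hrepr (⟨k.1.1, k.1.2.trans N.le_succ⟩, k.2)).symm
  -- The rank of `H_{f,N,N}` enters here: columns of words of length at most `N` already span, so
  -- `Rbar` has full row rank.
  have hpinv : Rbar * pinv Rbar = 1 := by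
    apply mul_pinv_eq_one
    have htop : Submodule.span ℝ (Set.range fun k : Word D N × Fin D × Fin m =>
        hankelCol f (k.1.1, k.2)) = ⊤ := by
      apply Submodule.map_injective_of_injective (colSpace (hankel f)).injective_subtype
      rw [Submodule.map_span, ← Set.range_comp, Submodule.map_top, Submodule.range_subtype]
      exact (colSpace_of_eRank_submatrix_eq h).1
    have hcols : Set.range Rbar.col = e.equivFun.toLinearMap ''
        Set.range fun k : Word D N × Fin D × Fin m => hankelCol f (k.1.1, k.2) := by
      rw [← Set.range_comp]
      exact congrArg Set.range (funext hRbar)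
    rw [hcols, ← Submodule.map_span, htop, Submodule.map_top, LinearEquiv.range]
  have hA : ∀ q, (realizationAlgorithm c).A q = LinearMap.toMatrix e e (T q) := by
    intro q
    -- The words `v q` reach length `N + 1`, whence the extra block columns of the input.
    let Rshift : Matrix (Fin (hankelSub f N (N + 1)).rank) (Word D N × Fin D × Fin m) ℝ :=
      Matrix.of fun r k => c.R r (⟨k.1.1 ++ [q], by simpa using k.1.2⟩, k.2)
    have hshift : Rshift = LinearMap.toMatrix e e (T q) * Rbar := by
      refine ext_col fun k => ?_
      have h₁ := LinearMap.toMatrix_mulVec_repr e e (T q) (hankelCol f (k.1.1, k.2))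
      rw [hT] at h₁
      have h₂ := hrepr (⟨k.1.1 ++ [q], by simpa using k.1.2⟩, k.2)
      exact h₂.symm.trans (h₁.symm.trans (congrArg _ (hRbar k).symm))
    change Rshift * pinv Rbar = _
    rw [hshift, Matrix.mul_assoc, hpinv, Matrix.mul_one]
  have hstate : ∀ j, (realizationAlgorithm c).transition v *ᵥ
      ((realizationAlgorithm c).B q₀).col j = e.repr (hankelCol f (v, q₀, j)) := by
    intro j
    induction v using List.reverseRecOn with
    | nil =>
      rw [LSS.transition_nil, one_mulVec]
      exact (hrepr (⟨[], Nat.zero_le _⟩, q₀, j)).symm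
    | append_singleton v σ ih =>
      rw [LSS.transition_concat, ← mulVec_mulVec, ih, hA, LinearMap.toMatrix_mulVec_repr, hT]
  ext l j
  rw [Matrix.mul_assoc]
  change _ = (realizationAlgorithm c).C q l ⬝ᵥ ((realizationAlgorithm c).transition v *ᵥ
      ((realizationAlgorithm c).B q₀).col j)
  rw [hstate]
  -- The rows of `C_q` hold the ε-row entries of the basis columns, so applying `C_q` evaluates the
  -- basis expansion there.
  have hsum := congrFun (congrArg Subtype.val (e.sum_repr (hankelCol f (v, q₀, j)))) ([], q, l)
  simp only [Submodule.coe_sum, Submodule.coe_smul, Finset.sum_apply, Pi.smul_apply, he] at hsum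
  have hleft : markov f q₀ v q l j = (hankelCol f (v, q₀, j)).1 ([], q, l) := by
    simp [hankelCol, hankel, combinedMarkov]
  rw [hleft, ← hsum]
  exact Finset.sum_congr rfl fun r _ => mul_comm _ _

end Realization

/-- The matrix is squeezed between `H_{f,N,N}` and `H_f`. -/
theorem eRank_hankelSub_succ {D m p N : ℕ} {f : IOMap D m p}
    (h : (hankelSub f N N).eRank = (hankel f).eRank) :
    (hankelSub f N (N + 1)).eRank = (hankel f).eRank := by
  refine le_antisymm (eRank_submatrix_le _ _ _) (h ▸ ?_)
  exact eRank_submatrix_le (hankelSub f N (N + 1)) id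
    (Prod.map (fun v : Word D N => (⟨v.1, v.2.trans N.le_succ⟩ : Word D (N + 1))) id)

theorem LSS.IsRealization.eRank_hankel_le {D m p n : ℕ} {f : IOMap D m p} {S : LSS D m p n}
    (hS : S.IsRealization f) : (hankel f).eRank ≤ n := by
  rw [hS, S.hankel_ioMap]
  exact eRank_mul_le _ _

/-- Ranks are dimensions of column spans with values in `ℕ∞` (`Matrix.eRank`), so that an infinite
rank of `H_f` is never confused with a finite one. -/
theorem theorem1 (D m p : ℕ) (f : IOMap D m p) (N : ℕ) :
    (HasGCR f → (hankelSub f N N).eRank = (hankel f).eRank →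
      ∀ c : ColumnChoice (hankelSub f N (N + 1)),
        (realizationAlgorithm c).IsMinimalRealization f) ∧
    ((∃ (n : ℕ) (S : LSS D m p n), n ≤ N + 1 ∧ S.IsRealization f) →
      (hankelSub f N N).eRank = (hankel f).eRank) := by
  refine ⟨fun hf h c => ⟨hf.isRealization _ fun q₀ v q =>
    realizationAlgorithm_markov f h c (eRank_hankelSub_succ h) q₀ v q, fun k T hT => ?_⟩, ?_⟩
  · rw [rank_eq_finrank_span_cols, ← eRank_toNat_eq_finrank, eRank_hankelSub_succ h]
    exact ENat.toNat_le_of_le_natCast hT.eRank_hankel_le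
  · rintro ⟨n, S, hn, hS⟩
    rw [hS]
    exact S.eRank_hankelSub_ioMap hn
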